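/- A word $w=w(x_1,\dots,x_r)$ is an element of the free group on $x_1,\dots,x_r$. For a finite group $G$, let $G_w=\{w(g_1,\dots,g_r): g_1,\dots,g_r\in G\}$ be its set of $w$-values. The word $w$ is called weakly rational if for every finite group $G$, every integer $e$ relatively prime to $|G|$ and every $g\in G$, one has $g\in G_w$ if and only if $g^e\in G_w$. It is called rational if for every finite group $G$, every integer $e$ relatively prime to $|G|$ and every $g\in G$, the equations $w(x_1,\dots,x_r)=g$ and $w(x_1,\dots,x_r)=g^e$ have the same number of solutions $(x_1,\dots,x_r)\in G^r$. Theorem. Let $w=w(x_1,\dots,x_r)$ be a word in $r$ variables, let $x_0$ be a new variable, and let $w'=[w,x_0]$, a word in the $r+1$ variables $x_0,x_1,\dots,x_r$, where $[a,b]=aba^{-1}b^{-1}$. If $w$ is weakly rational, then $w'$ is weakly rational; if $w$ is rational, then $w'$ is rational. -/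

import Mathlib

open scoped commutatorElement

universe u

/-- The value `w(x_1, …, x_r)` in the group `G` of a word `w` in `r` variables. -/
def wordValue {r : ℕ} (w : FreeGroup (Fin r)) {G : Type u} [Group G] (x : Fin r → G) : G :=
  FreeGroup.lift x w

/-- The set `G_w` of all values of the word `w` in the group `G`. -/
def wordValues {r : ℕ} (w : FreeGroup (Fin r)) (G : Type u) [Group G] : Set G :=
  Set.range fun x : Fin r → G => wordValue w x

/-- The number of solutions `(x_1, …, x_r) ∈ G ^ r` of the equation `w(x_1, …, x_r) = g`. -/
noncomputable def numSolutions {r : ℕ} (w : FreeGroup (Fin r)) {G : Type u} [Group G] (g : G) : ℕ :=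
  Nat.card {x : Fin r → G // wordValue w x = g}

/-- `w` is weakly rational: in every finite group `G`, for every integer `e` coprime to `|G|`,
an element `g` is a value of `w` if and only if `g ^ e` is. -/
def IsWeaklyRational {r : ℕ} (w : FreeGroup (Fin r)) : Prop :=
  ∀ (G : Type u) [Group G] [Finite G] (e : ℤ), IsCoprime e (Nat.card G : ℤ) →
    ∀ g : G, g ∈ wordValues w G ↔ g ^ e ∈ wordValues w G

/-- `w` is rational: in every finite group `G`, for every integer `e` coprime to `|G|`
and every `g ∈ G`, the equations `w = g` and `w = g ^ e` have the same number of solutions. -/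
def IsRational {r : ℕ} (w : FreeGroup (Fin r)) : Prop :=
  ∀ (G : Type u) [Group G] [Finite G] (e : ℤ), IsCoprime e (Nat.card G : ℤ) →
    ∀ g : G, numSolutions w g = numSolutions w (g ^ e)

/-- The word `w' = [w, x_0]` in the `r + 1` variables `x_0, x_1, …, x_r`, where
`w = w(x_1, …, x_r)`. The old variable with index `i : Fin r` becomes the one with index `i.succ`,
and the new variable `x_0` has index `0`. -/
def commutatorWord {r : ℕ} (w : FreeGroup (Fin r)) : FreeGroup (Fin (r + 1)) :=
  ⁅FreeGroup.map Fin.succ w, FreeGroup.of 0⁆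

/-! Since `⁅a, b⁆ = a * (b * a⁻¹ * b⁻¹)`, a count of commutators weighted by a class function `F`
reduces to the numbers `numConjQuotients c g`. It suffices that these are unchanged under `(c, g) ↦
(c ^ e, g ^ e)`. By Dirichlet, `e` may be replaced by a prime `p > |G| ^ 2`. On the centre of
`𝔽_p[G]`, raising to the power `p` just moves the coefficient at `u` to `u ^ p`; this gives
invariance mod `p`, hence equality by size. -/

open MonoidAlgebra in
/-- For a central element `z` of `𝔽_p[G]`, the coefficient of `z ^ p` at `u ^ p` is that of `z`
at `u`. -/
theorem coeff_pow_char_of_central {G : Type*} [Group G] [Fintype G] {p : ℕ} [Fact p.Prime]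
    (hp : (Nat.card G).Coprime p) (z : MonoidAlgebra (ZMod p) G) (hz : ∀ x, Commute z x) (u : G) :
    (z ^ p).coeff (u ^ p) = z.coeff u := by
  classical
  have hconj : ∀ y : MonoidAlgebra (ZMod p) G, (∀ x, Commute y x) → ∀ g a : G,
      y.coeff (g * a * g⁻¹) = y.coeff a := by
    intro y hy g a
    have h := congrArg (fun x => x.coeff (g * a)) (hy (single g 1)).eq
    simpa using h
  -- The map `a ↦ y * a * v⁻¹`: for central `y`, each diagonal entry is the coefficient of `y` at
  -- `v`.
  let T : MonoidAlgebra (ZMod p) G → G → Module.End (ZMod p) (MonoidAlgebra (ZMod p) G) :=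
    fun y v => LinearMap.mulLeft _ y * LinearMap.mulRight _ (single v⁻¹ 1)
  have htrace : ∀ y : MonoidAlgebra (ZMod p) G, (∀ x, Commute y x) → ∀ v : G,
      LinearMap.trace (ZMod p) _ (T y v) = (Nat.card G : ZMod p) * y.coeff v := by
    intro y hy v
    rw [LinearMap.trace_eq_matrix_trace (ZMod p) (MonoidAlgebra.basis G (ZMod p)), Matrix.trace]
    have : ∀ g : G, (LinearMap.toMatrix (MonoidAlgebra.basis G (ZMod p))
        (MonoidAlgebra.basis G (ZMod p)) (T y v)).diag g = y.coeff v := by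
      intro g
      rw [Matrix.diag_apply, LinearMap.toMatrix_apply, ← hconj y hy g v]
      simp [T, MonoidAlgebra.basis, mul_assoc]
    simp only [this]
    simp
  have hpow : T z u ^ p = T (z ^ p) (u ^ p) := by
    have hc : Commute (LinearMap.mulLeft (ZMod p) z)
        (LinearMap.mulRight (ZMod p) (single u⁻¹ (1 : ZMod p))) :=
      LinearMap.commute_mulLeft_right _ _
    simp only [T]
    rw [hc.mul_pow, LinearMap.pow_mulLeft, LinearMap.pow_mulRight]
    simp [single_pow]
  -- Over `𝔽_p`, `tr (A ^ p) = (tr A) ^ p`, which is `tr A` by Fermat.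
  have hmain := ZMod.trace_pow_card (LinearMap.toMatrix (MonoidAlgebra.basis G (ZMod p))
        (MonoidAlgebra.basis G (ZMod p)) (T z u))
  rw [LinearMap.toMatrix_pow, ← LinearMap.trace_eq_matrix_trace,
    ← LinearMap.trace_eq_matrix_trace, hpow, htrace _ (fun x => (hz x).pow_left p), htrace _ hz,
    ZMod.pow_card] at hmain
  have hne : (Nat.card G : ZMod p) ≠ 0 := ((ZMod.isUnit_iff_coprime _ _).2 hp).ne_zero
  exact mul_left_cancel₀ hne hmain

/-- The sum of all conjugates `x c x⁻¹`, with `x` running over `G`. -/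
noncomputable def conjSum (R : Type*) [Semiring R] {G : Type*} [Group G] [Fintype G] (c : G) :
    MonoidAlgebra R G :=
  ∑ x : G, MonoidAlgebra.single (x * c * x⁻¹) 1

theorem commute_conjSum {R : Type*} [CommSemiring R] {G : Type*} [Group G] [Fintype G] (c : G)
    (y : MonoidAlgebra R G) : Commute (conjSum R c) y := by
  induction y using MonoidAlgebra.induction_linear with
  | zero => exact Commute.zero_right _
  | add a b ha hb => exact ha.add_right hb
  | single g r =>
    rw [Commute, SemiconjBy, conjSum, Finset.sum_mul, Finset.mul_sum,
      ← Equiv.sum_comp (Equiv.mulLeft g)]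
    refine Finset.sum_congr rfl fun x _ => ?_
    simp [MonoidAlgebra.single_mul_single, mul_assoc]

theorem conjSum_pow_char {G : Type*} [Group G] [Fintype G] {p : ℕ} [Fact p.Prime]
    (hp : (Nat.card G).Coprime p) (c : G) :
    conjSum (ZMod p) c ^ p = conjSum (ZMod p) (c ^ p) := by
  classical
  ext g
  obtain ⟨u, rfl⟩ := (powCoprime hp).surjective g
  rw [powCoprime_apply, coeff_pow_char_of_central hp _ (commute_conjSum c)]
  simp only [conjSum, MonoidAlgebra.coeff_sum, MonoidAlgebra.coeff_single, Finsupp.finsetSum_apply,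
    Finsupp.single_apply]
  refine Finset.sum_congr rfl fun x _ => ?_
  rw [← conj_pow]
  congr 1
  exact propext (powCoprime hp).injective.eq_iff.symm

open Classical in
/-- The number of pairs `(x, y)` with `(x c x⁻¹) (y c⁻¹ y⁻¹) = g`. -/
noncomputable def numConjQuotients {G : Type*} [Group G] [Fintype G] (c g : G) : ℕ :=
  ∑ x : G, ∑ y : G, if x * c * x⁻¹ * (y * c⁻¹ * y⁻¹) = g then 1 else 0

theorem coeff_conjSum_mul_conjSum_inv {R : Type*} [CommSemiring R] {G : Type*} [Group G]
    [Fintype G] (c g : G) :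
    (conjSum R c * conjSum R c⁻¹).coeff g = (numConjQuotients c g : R) := by
  classical
  simp [conjSum, numConjQuotients, Finset.sum_mul_sum, MonoidAlgebra.single_mul_single,
    MonoidAlgebra.coeff_sum, Finsupp.finsetSum_apply, Finsupp.single_apply]

theorem numConjQuotients_le {G : Type*} [Group G] [Fintype G] (c g : G) :
    numConjQuotients c g ≤ Nat.card G * Nat.card G := by
  classical
  calc numConjQuotients c g ≤ ∑ _x : G, ∑ _y : G, 1 :=
        Finset.sum_le_sum fun x _ => Finset.sum_le_sum fun y _ => by split_ifs <;> simp
    _ = _ := by simp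

/-- Both counts are coefficients of central products of class sums, hence congruent mod `p`; both
are below `p`. -/
theorem numConjQuotients_pow {G : Type*} [Group G] [Fintype G] {p : ℕ} (hpp : p.Prime)
    (hp : (Nat.card G).Coprime p) (hlt : Nat.card G * Nat.card G < p) (c g : G) :
    numConjQuotients (c ^ p) (g ^ p) = numConjQuotients c g := by
  have : Fact p.Prime := ⟨hpp⟩
  have h : ((numConjQuotients (c ^ p) (g ^ p) : ℕ) : ZMod p) = (numConjQuotients c g : ℕ) := by
    rw [← coeff_conjSum_mul_conjSum_inv, ← coeff_conjSum_mul_conjSum_inv,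
      ← coeff_pow_char_of_central hp (conjSum (ZMod p) c * conjSum (ZMod p) c⁻¹)
        (fun x => (commute_conjSum c x).mul_left (commute_conjSum c⁻¹ x)),
      (commute_conjSum c _).mul_pow, conjSum_pow_char hp, conjSum_pow_char hp, inv_pow]
  rw [ZMod.natCast_eq_natCast_iff] at h
  exact h.eq_of_lt_of_lt ((numConjQuotients_le _ _).trans_lt hlt)
    ((numConjQuotients_le _ _).trans_lt hlt)

open Classical in
/-- The number of solutions of `⁅a, b⁆ = g`, where `a` is counted with weight `F a`. -/
noncomputable def commutatorCount {G : Type*} [Group G] [Fintype G] (F : G → ℕ) (g : G) : ℕ :=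
  ∑ a : G, ∑ b : G, if ⁅a, b⁆ = g then F a else 0

theorem card_mul_commutatorCount {G : Type*} [Group G] [Fintype G] (F : G → ℕ)
    (hF : ∀ x c, F (x * c * x⁻¹) = F c) (g : G) :
    Nat.card G * commutatorCount F g = ∑ c : G, F c * numConjQuotients c g := by
  classical
  have hc : ∀ c : G, F c * numConjQuotients c g =
      ∑ x : G, ∑ b : G, if ⁅x * c * x⁻¹, b⁆ = g then F (x * c * x⁻¹) else 0 := by
    intro c
    simp only [numConjQuotients, Finset.mul_sum]
    refine Finset.sum_congr rfl fun x _ => ?_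
    -- Substituting `y = b * x` makes the second factor `b * (x * c * x⁻¹)⁻¹ * b⁻¹`.
    rw [← Equiv.sum_comp (Equiv.mulRight x)]
    refine Finset.sum_congr rfl fun b _ => ?_
    rw [hF]
    simp [commutatorElement_def, mul_assoc]
  simp only [hc]
  rw [Finset.sum_comm]
  have hx : ∀ x : G, (∑ c : G, ∑ b : G, if ⁅x * c * x⁻¹, b⁆ = g then F (x * c * x⁻¹) else 0) =
      commutatorCount F g := fun x =>
    Equiv.sum_comp (MulAut.conj x).toEquiv fun a => ∑ b : G, if ⁅a, b⁆ = g then F a else 0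
  simp [hx]

theorem exists_prime_zpow_eq_pow (G : Type*) [Group G] [Finite G] {e : ℤ}
    (he : IsCoprime e (Nat.card G : ℤ)) (n : ℕ) :
    ∃ p > n, p.Prime ∧ (Nat.card G).Coprime p ∧ ∀ g : G, g ^ e = g ^ p := by
  obtain ⟨p, hpn, hpp, hmod⟩ :=
    -- A prime exceeding `|G|` is automatically coprime to it.
    Nat.forall_exists_prime_gt_and_zmodEq (max n (Nat.card G)) Nat.card_pos.ne' he
  refine ⟨p, (le_max_left _ _).trans_lt hpn, hpp, ?_, fun g => ?_⟩
  · exact (Nat.coprime_of_lt_prime Nat.card_pos.ne' ((le_max_right _ _).trans_lt hpn) hpp).symm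
  · rw [← zpow_natCast, zpow_eq_zpow_iff_modEq]
    exact (hmod.of_dvd (Int.natCast_dvd_natCast.2 (orderOf_dvd_natCard g))).symm

theorem commutatorCount_zpow {G : Type*} [Group G] [Fintype G] (F : G → ℕ)
    (hF : ∀ x c, F (x * c * x⁻¹) = F c) {e : ℤ} (he : IsCoprime e (Nat.card G : ℤ))
    (hFe : ∀ c, F c = F (c ^ e)) (g : G) :
    commutatorCount F g = commutatorCount F (g ^ e) := by
  obtain ⟨p, hlt, hpp, hp, hpe⟩ := exists_prime_zpow_eq_pow G he (Nat.card G * Nat.card G)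
  simp only [hpe] at hFe ⊢
  refine Nat.eq_of_mul_eq_mul_left (Nat.card_pos (α := G)) ?_
  rw [card_mul_commutatorCount F hF, card_mul_commutatorCount F hF,
    ← Equiv.sum_comp (powCoprime hp) fun c => F c * numConjQuotients c (g ^ p)]
  refine Finset.sum_congr rfl fun c _ => ?_
  rw [powCoprime_apply, ← hFe, numConjQuotients_pow hpp hp hlt]

theorem wordValue_conj {r : ℕ} (w : FreeGroup (Fin r)) {G : Type*} [Group G] (g : G)
    (x : Fin r → G) : wordValue w (fun i => g * x i * g⁻¹) = g * wordValue w x * g⁻¹ := by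
  have h : FreeGroup.lift (fun i => g * x i * g⁻¹) =
      (MulAut.conj g).toMonoidHom.comp (FreeGroup.lift x) := by
    ext i
    simp
  simpa [wordValue] using DFunLike.congr_fun h w

theorem mem_wordValues_conj {r : ℕ} (w : FreeGroup (Fin r)) {G : Type*} [Group G] (g c : G) :
    g * c * g⁻¹ ∈ wordValues w G ↔ c ∈ wordValues w G := by
  have key : ∀ h d : G, d ∈ wordValues w G → h * d * h⁻¹ ∈ wordValues w G := by
    rintro h _ ⟨x, rfl⟩
    exact ⟨_, wordValue_conj w h x⟩
  refine ⟨fun h => ?_, key g c⟩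
  simpa [mul_assoc] using key g⁻¹ _ h

theorem numSolutions_conj {r : ℕ} (w : FreeGroup (Fin r)) {G : Type*} [Group G] (g c : G) :
    numSolutions w (g * c * g⁻¹) = numSolutions w c := by
  refine (Nat.card_congr (Equiv.subtypeEquiv
    (Equiv.piCongrRight fun _ : Fin r => (MulAut.conj g).toEquiv) fun x => ?_)).symm
  have h : (Equiv.piCongrRight fun _ : Fin r => (MulAut.conj g).toEquiv) x =
      fun i => g * x i * g⁻¹ := rfl
  rw [h, wordValue_conj]
  simp

theorem wordValue_commutatorWord {r : ℕ} (w : FreeGroup (Fin r)) {G : Type*} [Group G]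
    (y : G) (x : Fin r → G) :
    wordValue (commutatorWord w) (Fin.cons y x : Fin (r + 1) → G) = ⁅wordValue w x, y⁆ := by
  have h : (FreeGroup.lift (Fin.cons y x : Fin (r + 1) → G)).comp (FreeGroup.map Fin.succ) =
      FreeGroup.lift x := by
    ext i
    simp
  have h' := DFunLike.congr_fun h w
  simp only [MonoidHom.comp_apply] at h'
  simp [wordValue, commutatorWord, map_commutatorElement, h']

theorem mem_wordValues_commutatorWord {r : ℕ} (w : FreeGroup (Fin r)) {G : Type*} [Group G]
    (g : G) : g ∈ wordValues (commutatorWord w) G ↔ ∃ a ∈ wordValues w G, ∃ b, ⁅a, b⁆ = g := by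
  constructor
  · rintro ⟨x, rfl⟩
    refine ⟨_, ⟨Fin.tail x, rfl⟩, x 0, ?_⟩
    dsimp only
    rw [← wordValue_commutatorWord, Fin.cons_self_tail]
  · rintro ⟨_, ⟨x, rfl⟩, b, rfl⟩
    exact ⟨Fin.cons b x, wordValue_commutatorWord w b x⟩

theorem numSolutions_commutatorWord {r : ℕ} (w : FreeGroup (Fin r)) {G : Type*} [Group G]
    [Fintype G] (g : G) :
    numSolutions (commutatorWord w) g = commutatorCount (numSolutions w) g := by
  classical
  have hL : numSolutions (commutatorWord w) g =
      ∑ b : G, ∑ x : Fin r → G, if ⁅wordValue w x, b⁆ = g then 1 else 0 := by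
    rw [numSolutions, Nat.card_eq_fintype_card, Fintype.card_subtype, Finset.card_filter,
      ← Equiv.sum_comp (Fin.consEquiv fun _ : Fin (r + 1) => G), Fintype.sum_prod_type]
    simp [Fin.consEquiv, wordValue_commutatorWord]
  have hw : ∀ a : G, numSolutions w a = ∑ x : Fin r → G, if wordValue w x = a then 1 else 0 := by
    intro a
    rw [numSolutions, Nat.card_eq_fintype_card, Fintype.card_subtype, Finset.card_filter]
  rw [hL, commutatorCount]
  conv_rhs => rw [Finset.sum_comm]
  refine Finset.sum_congr rfl fun b _ => ?_
  -- Sort the tuples by their value `a` of `w`.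
  have hx : ∀ x : Fin r → G, (if ⁅wordValue w x, b⁆ = g then (1 : ℕ) else 0) =
      ∑ a : G, if ⁅a, b⁆ = g then (if wordValue w x = a then 1 else 0) else 0 := by
    intro x
    simp only [← ite_and, and_comm (a := ⁅_, b⁆ = g)]
    simp [ite_and]
  simp only [hx, hw]
  rw [Finset.sum_comm]
  refine Finset.sum_congr rfl fun a _ => ?_
  split_ifs <;> simp

theorem mainTheorem1 {r : ℕ} (w : FreeGroup (Fin r)) :
    (IsWeaklyRational.{u} w → IsWeaklyRational.{u} (commutatorWord w)) ∧
      (IsRational.{u} w → IsRational.{u} (commutatorWord w)) := by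
  classical
  constructor
  · intro hw G _ _ e he g
    have : Fintype G := Fintype.ofFinite G
    -- With an indicator weight, the count is nonzero exactly at values of `⁅w, x₀⁆`.
    let F : G → ℕ := fun a => if a ∈ wordValues w G then 1 else 0
    have hpos : ∀ h : G, h ∈ wordValues (commutatorWord w) G ↔ commutatorCount F h ≠ 0 := by
      intro h
      rw [mem_wordValues_commutatorWord]
      simp [commutatorCount, F, and_comm]
    rw [hpos, hpos, ← commutatorCount_zpow F (fun x c => ?_) he (fun c => ?_) g]
    · simp only [F, mem_wordValues_conj]
    · simp only [F, hw G e he c]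
  · intro hw G _ _ e he g
    have : Fintype G := Fintype.ofFinite G
    rw [numSolutions_commutatorWord, numSolutions_commutatorWord]
    exact commutatorCount_zpow _ (numSolutions_conj w) he (hw G e he) g
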